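/- Let $r>0$, $0<p<1$, let $m\ge 0$ be an integer, and write $\mathbb{Z}_m=\{m,m+1,\dots\}$. Let $Z\sim \mathrm{NB}(r,p)$, that is, $$\Pr(Z=k)=\frac{\Gamma(r+k)}{\Gamma(r)\,k!}(1-p)^r p^k,\qquad k=0,1,2,\dots,$$ and let $\mathrm{NB}^{(m)}(r,p)$ be the conditional law of $Z$ given $Z\ge m$, with $\mathrm{NB}^{(m)}(r,p)\{f\}:=\mathbb{E}[f(Z)\mid Z\ge m]$. Let $\mathcal{F}_m=\{\mathbf{1}_A: A\subset \mathbb{Z}_m\}$. For $f\in\mathcal{F}_m$ let $g_{m,f}:\mathbb{Z}_m\to\mathbb{R}$ be the solution, unique except at $i=m$, of Stein's equation $$p(r+i)\,g(i+1)-i\,g(i)\mathbf{1}_{\{i>m\}}=f(i)-\mathrm{NB}^{(m)}(r,p)\{f\},\qquad i\in\mathbb{Z}_m,$$ and put $$G_{m,1}=\sup_{f\in\mathcal{F}_m}\ \sup_{w\in\mathbb{Z}_m}|g_{m,f}(w+1)|.$$ Then $$G_{m,1}\le \min\left\{\frac{1}{1-p},\ \frac{1.75}{\sqrt{rp(1-p)}}\right\}.$$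 -/

import Mathlib

open MeasureTheory
open scoped ENNReal

noncomputable section

/-- The mass function of the negative binomial distribution `NB(r, p)`:
`Γ(r + k) / (Γ(r) k!) * (1 - p) ^ r * p ^ k`. -/
def nbMass (r p : ℝ) (k : ℕ) : ℝ :=
  Real.Gamma (r + k) / (Real.Gamma r * (k.factorial : ℝ)) * (1 - p) ^ r * p ^ k

/-- The negative binomial distribution `NB(r, p)`, as a measure on `ℕ`. -/
def nbMeasure (r p : ℝ) : Measure ℕ :=
  Measure.sum fun k => ENNReal.ofReal (nbMass r p k) • Measure.dirac k

/-- The conditional negative binomial distribution `NB^(m)(r, p)`: the law of `Z` given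
`Z ≥ m`, where `Z ∼ NB(r, p)`. -/
def condNB (m : ℕ) (r p : ℝ) : Measure ℕ :=
  ProbabilityTheory.cond (nbMeasure r p) (Set.Ici m)

/-- The set `F_m` of the indicator functions of the subsets of `{m, m + 1, …}`. -/
def indicatorClass (m : ℕ) : Set (ℕ → ℝ) :=
  {f | ∃ A : Set ℕ, A ⊆ Set.Ici m ∧ f = A.indicator 1}

/-- The Stein operator `B_m` of `NB^(m)(r, p)`. -/
def steinOp (m : ℕ) (r p : ℝ) (g : ℕ → ℝ) (i : ℕ) : ℝ :=
  p * (r + i) * g (i + 1) - (i : ℝ) * g i * (Set.Ioi m).indicator 1 i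

/-- `g` solves Stein's equation `B_m g(i) = f(i) - NB^(m)(r, p){f}` for all `i ≥ m`.
Only the values of `g` on `{m, m + 1, …}` matter. -/
def IsSteinSolution (m : ℕ) (r p : ℝ) (f g : ℕ → ℝ) : Prop :=
  ∀ i : ℕ, m ≤ i → steinOp m r p g i = f i - ∫ k, f k ∂(condNB m r p)

/-- Stein's equation has a solution, for every right-hand side. -/
theorem exists_isSteinSolution (m : ℕ) {r p : ℝ} (hr : 0 < r) (hp : 0 < p) (f : ℕ → ℝ) :
    ∃ g : ℕ → ℝ, IsSteinSolution m r p f g := by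
  refine ⟨fun n => Nat.rec (motive := fun _ => ℝ) 0 (fun i x =>
    (f i - (∫ k, f k ∂(condNB m r p)) + (i : ℝ) * x * (Set.Ioi m).indicator 1 i) /
      (p * (r + i))) n, fun i _ => ?_⟩
  have h : p * (r + i) ≠ 0 := by positivity
  simp only [steinOp]
  rw [mul_div_cancel₀ _ h]
  ring

/-- The solution of Stein's equation is unique except at `m`. -/
theorem IsSteinSolution.eq_of_lt {m : ℕ} {r p : ℝ} (hr : 0 < r) (hp : 0 < p)
    {f g g' : ℕ → ℝ} (hg : IsSteinSolution m r p f g) (hg' : IsSteinSolution m r p f g')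
    {i : ℕ} (hi : m < i) : g i = g' i := by
  have key : ∀ i, m ≤ i → g (i + 1) = g' (i + 1) := by
    intro i hi
    induction i, hi using Nat.le_induction with
    | base =>
      have h : p * (r + (m : ℝ)) ≠ 0 := by positivity
      have e := (hg m le_rfl).trans (hg' m le_rfl).symm
      simp only [steinOp, Set.mem_Ioi, lt_irrefl, not_false_eq_true, Set.indicator_of_notMem,
        mul_zero, sub_zero] at e
      exact mul_left_cancel₀ h e
    | succ n hn ih =>
      have h : p * (r + ((n + 1 : ℕ) : ℝ)) ≠ 0 := by positivity
      have e := (hg (n + 1) (by omega)).trans (hg' (n + 1) (by omega)).symm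
      simp only [steinOp, ih, sub_left_inj] at e
      exact mul_left_cancel₀ h e
  obtain ⟨n, rfl⟩ : ∃ n, i = n + 1 := ⟨i - 1, by omega⟩
  exact key n (by omega)

/-- The solution `g_{m,f}` of Stein's equation for `NB^(m)(r, p)`. It is unique except at `m`,
so its values at `m + 1, m + 2, …` do not depend on the choice. -/
def steinSol (m : ℕ) {r p : ℝ} (hr : 0 < r) (hp : 0 < p) (f : ℕ → ℝ) : ℕ → ℝ :=
  Classical.choose (exists_isSteinSolution m hr hp f)

/-- `‖h‖_m = sup_{w ≥ m} |h(w + 1)|`, as an element of `[0, ∞]`. -/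
def normFrom (m : ℕ) (h : ℕ → ℝ) : ℝ≥0∞ :=
  ⨆ w ∈ Set.Ici m, ENNReal.ofReal |h (w + 1)|

/-- Stein's factor `G_{m,1} = sup_{f ∈ F_m} ‖g_{m,f}‖_m` for `NB^(m)(r, p)`,
as an element of `[0, ∞]`. -/
def steinFactorOne (m : ℕ) {r p : ℝ} (hr : 0 < r) (hp : 0 < p) : ℝ≥0∞ :=
  ⨆ f ∈ indicatorClass m, normFrom m (steinSol m hr hp f)

end

/-! ### The weights of the negative binomial distribution -/

section Weights

variable {r p : ℝ}

/-! Let a be the mass function, b = w a_w, and let S, T be the masses of [0, w) and [w, ∞).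
Multiplied by a_i, Stein's equation telescopes by detailed balance (`nbMass_succ`), so b (S' + T)
g(w) = U T - V S', where S' is the mass of [m, w) and U ≤ S', V ≤ T are the masses of A in [m, w)
and [w, ∞). Hence |g(w)| ≤ S'T / (b (S' + T)). This grows with S', so it suffices to treat m = 0,
that is, to show S T ≤ K b (S + T) for both constants K.

Summing detailed balance on either side of w gives (1 - p) S (T + E) ≤ b (S + T), with E the excess
over w (`mul_add_excess_le`). Dropping E yields K = 1 / (1 - p). Lower bounds for E by multiples of
T yield the square-root constant if r ≤ 1 or rp(1 - p) ≤ 49/16. Otherwise S / b below the mean, or T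
/ b above it, is a discrete Mills ratio, bounded by an explicit supersolution of its recursion
(`sum_or_tail_le`). -/

theorem nbMass_pos (hr : 0 < r) (hp : 0 < p) (hp1 : p < 1) (k : ℕ) : 0 < nbMass r p k := by
  have h1 : 0 < Real.Gamma (r + k) := Real.Gamma_pos_of_pos (by positivity)
  have h2 : 0 < Real.Gamma r := Real.Gamma_pos_of_pos hr
  have h3 : 0 < (1 - p) ^ r := Real.rpow_pos_of_pos (by linarith) r
  have h4 : (0 : ℝ) < k.factorial := by exact_mod_cast k.factorial_pos
  unfold nbMass
  positivity

/-- Detailed balance for the weights of `NB(r, p)`. -/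
theorem nbMass_succ (hr : 0 < r) (k : ℕ) :
    ((k : ℝ) + 1) * nbMass r p (k + 1) = p * (r + k) * nbMass r p k := by
  have h2 : Real.Gamma r ≠ 0 := (Real.Gamma_pos_of_pos hr).ne'
  have h4 : (k.factorial : ℝ) ≠ 0 := by exact_mod_cast k.factorial_ne_zero
  have h5 : ((k : ℝ) + 1) ≠ 0 := by positivity
  have h6 : Real.Gamma (r + (k + 1 : ℕ)) = (r + k) * Real.Gamma (r + k) := by
    rw [Nat.cast_add_one, ← add_assoc]
    exact Real.Gamma_add_one (by positivity)
  unfold nbMass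
  rw [h6, Nat.factorial_succ, pow_succ]
  push_cast
  field_simp

theorem summable_mul_nbMass (hr : 0 < r) (hp : 0 < p) (hp1 : p < 1) :
    Summable fun k : ℕ => (k : ℝ) * nbMass r p k := by
  have ha := nbMass_pos hr hp hp1
  refine summable_of_ratio_test_tendsto_lt_one (l := p) hp1 ?_ ?_
  · filter_upwards [Filter.eventually_gt_atTop 0] with k hk
    have : (0 : ℝ) < k := by exact_mod_cast hk
    exact (mul_pos this (ha k)).ne'
  · have h1 : Filter.Tendsto (fun k : ℕ => p * r / (k : ℝ) + p) Filter.atTop (nhds (0 + p)) :=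
      (tendsto_const_div_atTop_nhds_zero_nat (p * r)).add tendsto_const_nhds
    rw [zero_add] at h1
    refine h1.congr' ?_
    filter_upwards [Filter.eventually_gt_atTop 0] with k hk
    have hk' : (0 : ℝ) < k := by exact_mod_cast hk
    have hak := ha k
    have e := nbMass_succ (p := p) hr k
    rw [Real.norm_of_nonneg (by have := ha (k + 1); positivity),
      Real.norm_of_nonneg (by positivity), Nat.cast_add_one, e]
    field_simp

theorem summable_nbMass (hr : 0 < r) (hp : 0 < p) (hp1 : p < 1) : Summable (nbMass r p) := by
  rw [← summable_nat_add_iff 1]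
  refine Summable.of_nonneg_of_le (fun k => (nbMass_pos hr hp hp1 _).le) (fun k => ?_)
    ((summable_nat_add_iff 1).2 (summable_mul_nbMass hr hp hp1))
  have := nbMass_pos hr hp hp1 (k + 1)
  push_cast
  nlinarith [k.cast_nonneg (α := ℝ)]

/-- The mass that the weights of `NB(r, p)` put on `{w, w + 1, …}`. -/
noncomputable def nbTail (r p : ℝ) (w : ℕ) : ℝ := ∑' j, nbMass r p (w + j)

theorem summable_nbMass_add (hr : 0 < r) (hp : 0 < p) (hp1 : p < 1) (w : ℕ) :
    Summable fun j => nbMass r p (w + j) := by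
  simpa only [add_comm] using (summable_nat_add_iff w).2 (summable_nbMass hr hp hp1)

theorem summable_mul_nbMass_add (hr : 0 < r) (hp : 0 < p) (hp1 : p < 1) (w : ℕ) :
    Summable fun j : ℕ => (j : ℝ) * nbMass r p (w + j) := by
  refine Summable.of_nonneg_of_le
    (fun j => mul_nonneg j.cast_nonneg (nbMass_pos hr hp hp1 _).le) (fun j => ?_)
    ((summable_nat_add_iff w).2 (summable_mul_nbMass hr hp hp1))
  rw [add_comm j w]
  refine mul_le_mul_of_nonneg_right ?_ (nbMass_pos hr hp hp1 _).le
  exact_mod_cast Nat.le_add_left j w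

theorem nbTail_pos (hr : 0 < r) (hp : 0 < p) (hp1 : p < 1) (w : ℕ) : 0 < nbTail r p w :=
  (summable_nbMass_add hr hp hp1 w).tsum_pos (fun _ => (nbMass_pos hr hp hp1 _).le) 0
    (nbMass_pos hr hp hp1 _)

/-- The excess `∑_{j ≥ w} (j - w) a_j` of the weights of `NB(r, p)` over `w`. -/
noncomputable def nbExcess (r p : ℝ) (w : ℕ) : ℝ := ∑' j : ℕ, (j : ℝ) * nbMass r p (w + j)

theorem nbExcess_nonneg (hr : 0 < r) (hp : 0 < p) (hp1 : p < 1) (w : ℕ) : 0 ≤ nbExcess r p w :=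
  tsum_nonneg fun j => mul_nonneg j.cast_nonneg (nbMass_pos hr hp hp1 _).le

theorem nbExcess_eq_tsum_succ (hr : 0 < r) (hp : 0 < p) (hp1 : p < 1) (w : ℕ) :
    nbExcess r p w = ∑' j : ℕ, ((j : ℝ) + 1) * nbMass r p (w + j + 1) := by
  unfold nbExcess
  rw [(summable_mul_nbMass_add hr hp hp1 w).tsum_eq_zero_add]
  simp [add_assoc]

theorem summable_succ_mul_nbMass (hr : 0 < r) (hp : 0 < p) (hp1 : p < 1) (w : ℕ) :
    Summable fun j : ℕ => ((j : ℝ) + 1) * nbMass r p (w + j + 1) := by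
  simpa [add_assoc] using (summable_nat_add_iff 1).2 (summable_mul_nbMass_add hr hp hp1 w)

theorem nbTail_eq_add (hr : 0 < r) (hp : 0 < p) (hp1 : p < 1) (w : ℕ) :
    nbTail r p w = nbMass r p w + ∑' j : ℕ, nbMass r p (w + j + 1) := by
  unfold nbTail
  rw [(summable_nbMass_add hr hp hp1 w).tsum_eq_zero_add]
  simp [add_assoc]

/-- Detailed balance summed over all indices k ≥ w. -/
theorem mul_nbMass_eq_tail (hr : 0 < r) (hp : 0 < p) (hp1 : p < 1) (w : ℕ) :
    w * nbMass r p w =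
      (1 - p) * (nbExcess r p w + w * nbTail r p w) - p * r * nbTail r p w := by
  have hT := summable_nbMass_add hr hp hp1 w
  have hE := summable_mul_nbMass_add hr hp hp1 w
  have hT' : Summable fun j : ℕ => nbMass r p (w + j + 1) := by
    simpa [add_assoc] using (summable_nat_add_iff 1).2 hT
  have key : nbExcess r p w + w * ∑' j : ℕ, nbMass r p (w + j + 1) =
      p * (r + w) * nbTail r p w + p * nbExcess r p w := by
    rw [nbExcess_eq_tsum_succ hr hp hp1, ← tsum_mul_left,
      ← (summable_succ_mul_nbMass hr hp hp1 w).tsum_add (hT'.mul_left _),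
      ← nbExcess_eq_tsum_succ hr hp hp1, nbExcess, nbTail, ← tsum_mul_left, ← tsum_mul_left,
      ← (hT.mul_left _).tsum_add (hE.mul_left _)]
    refine tsum_congr fun j => ?_
    have e := nbMass_succ (p := p) hr (w + j)
    push_cast at e
    linear_combination e
  linear_combination (-(w : ℝ)) * nbTail_eq_add hr hp hp1 w - key

/-- The companion identity: detailed balance summed over k < w. -/
theorem mul_nbMass_eq_sum (hr : 0 < r) (w : ℕ) :
    w * nbMass r p w = p * r * ∑ j ∈ Finset.range w, nbMass r p j -
      (1 - p) * ∑ j ∈ Finset.range w, (j : ℝ) * nbMass r p j := by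
  induction w with
  | zero => simp
  | succ n ih =>
    rw [Finset.sum_range_succ, Finset.sum_range_succ, Nat.cast_add_one, nbMass_succ hr n]
    linear_combination ih

theorem mul_add_excess_le (hr : 0 < r) (hp : 0 < p) (hp1 : p < 1) (w : ℕ) :
    (1 - p) * ((∑ j ∈ Finset.range w, nbMass r p j) * (nbTail r p w + nbExcess r p w)) ≤
      w * nbMass r p w * (∑ j ∈ Finset.range w, nbMass r p j + nbTail r p w) := by
  have h1 := mul_nbMass_eq_tail hr hp hp1 w
  have h2 := mul_nbMass_eq_sum (p := p) hr w
  have h3 : ∑ j ∈ Finset.range w, (j : ℝ) * nbMass r p j ≤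
      (w - 1) * ∑ j ∈ Finset.range w, nbMass r p j := by
    rw [Finset.mul_sum]
    refine Finset.sum_le_sum fun j hj => ?_
    have : (j : ℝ) + 1 ≤ w := by exact_mod_cast Finset.mem_range.1 hj
    exact mul_le_mul_of_nonneg_right (by linarith) (nbMass_pos hr hp hp1 j).le
  have hT := nbTail_pos hr hp hp1 w
  set S := ∑ j ∈ Finset.range w, nbMass r p j
  set L := ∑ j ∈ Finset.range w, (j : ℝ) * nbMass r p j
  set T := nbTail r p w
  set E := nbExcess r p w
  -- Weighting the two identities by S and T cancels the terms in p r.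
  have e : w * nbMass r p w * (S + T) = (1 - p) * (S * (E + w * T) - T * L) := by
    linear_combination S * h1 + T * h2
  rw [e]
  refine mul_le_mul_of_nonneg_left ?_ (by linarith)
  nlinarith [mul_le_mul_of_nonneg_left h3 hT.le]

/-- For r ≥ 1 the ratio a_{k+1} / a_k = p(r + k)/(k + 1) is at least p, so shifting the sum for the
excess E by one gives E ≥ p(E + T). -/
theorem tail_le_excess_of_one_le (hr : 1 ≤ r) (hp : 0 < p) (hp1 : p < 1) (w : ℕ) :
    p * nbTail r p w ≤ (1 - p) * nbExcess r p w := by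
  have hr0 : 0 < r := by linarith
  have key : p * nbExcess r p w + p * nbTail r p w ≤ nbExcess r p w := by
    conv_rhs => rw [nbExcess_eq_tsum_succ hr0 hp hp1]
    rw [nbExcess, nbTail, ← tsum_mul_left, ← tsum_mul_left,
      ← ((summable_mul_nbMass_add hr0 hp hp1 w).mul_left _).tsum_add
        ((summable_nbMass_add hr0 hp hp1 w).mul_left _)]
    refine Summable.tsum_le_tsum (fun j => ?_)
      (((summable_mul_nbMass_add hr0 hp hp1 w).mul_left _).add
        ((summable_nbMass_add hr0 hp hp1 w).mul_left _)) (summable_succ_mul_nbMass hr0 hp hp1 w)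
    have e := nbMass_succ (p := p) hr0 (w + j)
    have h0 := nbMass_pos hr0 hp hp1 (w + j)
    have h1 : p * nbMass r p (w + j) ≤ nbMass r p (w + j + 1) := by
      have hc : (0 : ℝ) < (w + j : ℕ) + 1 := by positivity
      refine le_of_mul_le_mul_left ?_ hc
      rw [e]
      nlinarith [mul_pos hp h0]
    nlinarith [j.cast_nonneg (α := ℝ)]
  linarith

/-- For r ≤ 1 the ratio a_{k+1} / a_k is at most p, so the tail is dominated by a geometric series.
-/
theorem tail_le_nbMass_of_le_one (hr : 0 < r) (hr1 : r ≤ 1) (hp : 0 < p) (hp1 : p < 1) (w : ℕ) :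
    (1 - p) * nbTail r p w ≤ nbMass r p w := by
  have hT := summable_nbMass_add hr hp hp1 w
  have hT' : Summable fun j : ℕ => nbMass r p (w + j + 1) := by
    simpa [add_assoc] using (summable_nat_add_iff 1).2 hT
  have key : ∑' j : ℕ, nbMass r p (w + j + 1) ≤ p * nbTail r p w := by
    rw [nbTail, ← tsum_mul_left]
    refine hT'.tsum_le_tsum (fun j => ?_) (hT.mul_left _)
    have e := nbMass_succ (p := p) hr (w + j)
    have h0 := nbMass_pos hr hp hp1 (w + j)
    have hc : (0 : ℝ) < (w + j : ℕ) + 1 := by positivity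
    refine le_of_mul_le_mul_left ?_ hc
    rw [e]
    nlinarith [mul_pos hp h0]
  linarith [nbTail_eq_add hr hp hp1 w]

theorem tail_le_excess_of_le_one (hr : 0 < r) (hr1 : r ≤ 1) (hp : 0 < p) (hp1 : p < 1) (w : ℕ) :
    p * r * nbTail r p w ≤ (1 - p) * nbExcess r p w := by
  have h1 := mul_nbMass_eq_tail hr hp hp1 w
  have h2 := mul_le_mul_of_nonneg_left (tail_le_nbMass_of_le_one hr hr1 hp hp1 w)
    (w.cast_nonneg (α := ℝ))
  linarith

end Weights

/-! ### A supersolution of the Stein recursion -/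

section Supersolution

/-- The profile of the supersolution of the Stein recursion, in the standardized distance from the
mean. -/
noncomputable def steinProfile (y : ℝ) : ℝ := 3 / 5 + 3 / 10 * max (41 / 21 - y) 0 ^ 2

theorem steinProfile_ge (y : ℝ) : 3 / 5 ≤ steinProfile y := by
  unfold steinProfile
  nlinarith [sq_nonneg (max (41 / 21 - y) 0)]

theorem steinProfile_antitone : Antitone steinProfile := by
  intro x y hxy
  unfold steinProfile
  have h : max (41 / 21 - y) 0 ≤ max (41 / 21 - x) 0 := max_le_max_right _ (by linarith)
  gcongr

theorem steinProfile_le {y : ℝ} (hy : 0 ≤ y) : steinProfile y ≤ 1.75 := by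
  refine (steinProfile_antitone hy).trans ?_
  unfold steinProfile
  rw [max_eq_left (by norm_num)]
  norm_num

theorem steinProfile_of_le {y : ℝ} (hy : y ≤ 41 / 21) :
    steinProfile y = 3 / 5 + 3 / 10 * (41 / 21 - y) ^ 2 := by
  rw [steinProfile, max_eq_left (by linarith)]

theorem steinProfile_le_quadratic (y : ℝ) :
    steinProfile y ≤ 3 / 5 + 3 / 10 * (41 / 21 - y) ^ 2 := by
  unfold steinProfile
  rcases max_cases (41 / 21 - y) 0 with h | h <;> rw [h.1]
  nlinarith [sq_nonneg (41 / 21 - y)]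

/-- Discrete form of 1 ≤ -φ' + yφ, the inequality for supersolutions of the Mills ratio equation.
Left of 41/21 the linear terms cancel because 2 · 3/10 = 3/5, and 3/5 · 41/21 = 1 + 6/35 leaves a
slack of 6/35 = 3/10 · 4/7, which absorbs the discretization error 3/10 · δ. Right of 41/21, already
yφ ≥ 1. -/
theorem steinProfile_forward {δ y : ℝ} (hδ : 0 < δ) (hδ1 : δ ≤ 4 / 7) (hy : 0 ≤ y) :
    δ ≤ steinProfile y - steinProfile (y + δ) + δ * (y * steinProfile y) := by
  rcases le_total y (41 / 21) with h | h
  · have h1 := steinProfile_le_quadratic (y + δ)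
    rw [steinProfile_of_le h]
    have h2 : 0 ≤ δ * (4 / 7 - δ) := mul_nonneg hδ.le (by linarith)
    have h3 : 0 ≤ δ * (y * (41 / 21 - y) ^ 2) := by positivity
    nlinarith
  · have h1 := steinProfile_antitone (show y ≤ y + δ by linarith)
    have h2 : 1 ≤ y * steinProfile y := by nlinarith [steinProfile_ge y]
    nlinarith

/-- The analogue below the mean. The discretization error now has the favourable sign; the slack
6/35 pays for the correction ε, which costs at most 3/10 · y/16 with y ≤ 41/21. -/
theorem steinProfile_backward {δ ε y : ℝ} (hδ : 0 < δ) (hε1 : ε ^ 2 ≤ 1 / 16)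
    (hy : 0 ≤ y) (hεy : ε * y ≤ 1) :
    δ ≤ (1 - ε * y) * (steinProfile (y - δ) - steinProfile y) + δ * (y * steinProfile y) := by
  rcases le_total y (41 / 21) with h | h
  · rw [steinProfile_of_le h, steinProfile_of_le (show y - δ ≤ 41 / 21 by linarith)]
    have e : (1 - ε * y) * (3 / 5 + 3 / 10 * (41 / 21 - (y - δ)) ^ 2 -
        (3 / 5 + 3 / 10 * (41 / 21 - y) ^ 2)) +
        δ * (y * (3 / 5 + 3 / 10 * (41 / 21 - y) ^ 2)) =
        δ + δ * (6 / 35 + 3 / 10 * (1 - ε * y) * δ +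
          3 / 10 * y * ((41 / 21 - y - ε) ^ 2 - ε ^ 2)) := by ring
    rw [e]
    have h1 : 0 ≤ (1 - ε * y) * δ := mul_nonneg (by linarith) hδ.le
    have h2 : -(1 / 16) * y ≤ y * ((41 / 21 - y - ε) ^ 2 - ε ^ 2) := by
      nlinarith [sq_nonneg (41 / 21 - y - ε)]
    nlinarith
  · have h1 := steinProfile_antitone (show y - δ ≤ y by linarith)
    have h2 : 1 ≤ y * steinProfile y := by nlinarith [steinProfile_ge y]
    have h3 : 0 ≤ (1 - ε * y) * (steinProfile (y - δ) - steinProfile y) :=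
      mul_nonneg (by linarith) (by linarith)
    nlinarith

/-! ### From supersolutions to bounds for the lower part and the tail -/

variable {r p : ℝ}

/-- Multiplied by a_n, the hypothesis bounds a_n by a telescoping difference of n ψ(n) a_n;
nonnegativity of ψ discards the far boundary term. -/
theorem nbTail_le_of_supersolution (hr : 0 < r) (hp : 0 < p) (hp1 : p < 1) {ψ : ℕ → ℝ} {w : ℕ}
    (h0 : ∀ n, 0 ≤ ψ n) (h : ∀ n, w ≤ n → 1 + p * (r + n) * ψ (n + 1) ≤ n * ψ n) :
    nbTail r p w ≤ ψ w * (w * nbMass r p w) := by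
  have ha := nbMass_pos hr hp hp1
  refine Real.tsum_le_of_sum_range_le (fun j => (ha _).le) fun n => ?_
  have key : ∑ j ∈ Finset.range n, nbMass r p (w + j) ≤
      ψ w * (w * nbMass r p w) - ψ (w + n) * ((w + n : ℕ) * nbMass r p (w + n)) := by
    induction n with
    | zero => simp
    | succ n ih =>
      rw [Finset.sum_range_succ, ← add_assoc, Nat.cast_add_one, nbMass_succ hr]
      have := mul_le_mul_of_nonneg_right (h (w + n) (Nat.le_add_right w n)) (ha (w + n)).le
      linarith
  have : 0 ≤ ψ (w + n) * ((w + n : ℕ) * nbMass r p (w + n)) :=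
    mul_nonneg (h0 _) (mul_nonneg (Nat.cast_nonneg _) (ha _).le)
  linarith

theorem sum_nbMass_le_of_supersolution (hr : 0 < r) (hp : 0 < p) (hp1 : p < 1) {ψ : ℕ → ℝ} {w : ℕ}
    (h : ∀ n, n < w → 1 + n * ψ n ≤ p * (r + n) * ψ (n + 1)) :
    ∑ j ∈ Finset.range w, nbMass r p j ≤ ψ w * (w * nbMass r p w) := by
  induction w with
  | zero => simp
  | succ n ih =>
    rw [Finset.sum_range_succ, Nat.cast_add_one, nbMass_succ hr]
    have h1 := ih fun k hk => h k (by omega)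
    have h2 := mul_le_mul_of_nonneg_right (h n (by omega)) (nbMass_pos hr hp hp1 n).le
    linarith

theorem steinProfile_recursion_above {s n : ℝ} (hp : 0 < p) (hp1 : p < 1) (hs : 0 < s)
    (hsr : s ^ 2 = r * p) (hδ : (1 - p) / s ≤ 4 / 7) (hn : s ^ 2 ≤ (1 - p) * n) :
    1 + p * (r + n) * (steinProfile (((1 - p) * (n + 1) - s ^ 2) / s) / s) ≤
      n * (steinProfile (((1 - p) * n - s ^ 2) / s) / s) := by
  have hq : 0 < 1 - p := by linarith
  -- The mean is s²/(1 - p) and the standard deviation s/(1 - p), so y is the standardized distance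
  -- of n from the mean and δ the step of the standardized lattice.
  obtain ⟨y, hy⟩ : ∃ y, y = ((1 - p) * n - s ^ 2) / s := ⟨_, rfl⟩
  obtain ⟨δ, hδe⟩ : ∃ δ, δ = (1 - p) / s := ⟨_, rfl⟩
  have hδ0 : 0 < δ := by rw [hδe]; positivity
  have hy0 : 0 ≤ y := by rw [hy]; exact div_nonneg (by linarith) hs.le
  have e1 : ((1 - p) * (n + 1) - s ^ 2) / s = y + δ := by rw [hy, hδe]; ring
  have hps : 1 - p = δ * s := by rw [hδe]; field_simp
  have hns : n * δ = s + y := by rw [hy, hδe]; field_simp; ring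
  have hrn : p * (r + n) * δ = s + p * y := by linear_combination p * hns - δ * hsr - s * hps
  rw [← hy, e1]
  have key := steinProfile_forward hδ0 (hδe ▸ hδ) hy0
  have hmono := steinProfile_antitone (show y ≤ y + δ by linarith)
  set φ := steinProfile y
  set φ' := steinProfile (y + δ)
  refine le_of_mul_le_mul_left ?_ (mul_pos hδ0 hs)
  have l : δ * s * (1 + p * (r + n) * (φ' / s)) = δ * s + (s + p * y) * φ' := by
    rw [← hrn]; field_simp
  have l' : δ * s * (n * (φ / s)) = (s + y) * φ := by rw [← hns]; field_simp
  rw [l, l']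
  have h1 : 0 ≤ p * y * (φ - φ') := mul_nonneg (by positivity) (by linarith)
  have h2 := mul_le_mul_of_nonneg_left key hs.le
  have h3 : s * (δ * (y * φ)) = (1 - p) * (y * φ) := by rw [hps]; ring
  linarith

theorem steinProfile_recursion_below {s n : ℝ} (hr : 0 < r) (hp : 0 < p) (hp1 : p < 1) (hs : 0 < s)
    (hsr : s ^ 2 = r * p) (hε : p / r ≤ 1 / 16) (hn0 : 0 ≤ n) (hn : (1 - p) * n ≤ s ^ 2) :
    1 + n * (steinProfile ((s ^ 2 - (1 - p) * n) / s) / s) ≤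
      p * (r + n) * (steinProfile ((s ^ 2 - (1 - p) * (n + 1)) / s) / s) := by
  have hq : 0 < 1 - p := by linarith
  obtain ⟨y, hy⟩ : ∃ y, y = (s ^ 2 - (1 - p) * n) / s := ⟨_, rfl⟩
  obtain ⟨δ, hδe⟩ : ∃ δ, δ = (1 - p) / s := ⟨_, rfl⟩
  have hδ0 : 0 < δ := by rw [hδe]; positivity
  have hy0 : 0 ≤ y := by rw [hy]; exact div_nonneg (by linarith) hs.le
  have e1 : (s ^ 2 - (1 - p) * (n + 1)) / s = y - δ := by rw [hy, hδe]; ring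
  have hps : 1 - p = δ * s := by rw [hδe]; field_simp
  have hns : n * δ = s - y := by rw [hy, hδe]; field_simp; ring
  have hrn : p * (r + n) * δ = s - p * y := by linear_combination p * hns - δ * hsr - s * hps
  have hys : y ≤ s := by nlinarith [mul_nonneg hn0 hδ0.le]
  have hεsq : (p / s) ^ 2 ≤ 1 / 16 := by
    rw [div_pow, hsr]
    convert hε using 1
    field_simp
  have hεy : p / s * y ≤ 1 := by
    rw [div_mul_eq_mul_div, div_le_one hs]
    nlinarith
  rw [← hy, e1]
  have key := steinProfile_backward hδ0 hεsq hy0 hεy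
  set φ := steinProfile y
  set φ' := steinProfile (y - δ)
  refine le_of_mul_le_mul_left ?_ (mul_pos hδ0 hs)
  have l : δ * s * (p * (r + n) * (φ' / s)) = (s - p * y) * φ' := by
    rw [← hrn]; field_simp
  have l' : δ * s * (1 + n * (φ / s)) = δ * s + (s - y) * φ := by rw [← hns]; field_simp
  rw [l, l']
  have h2 := mul_le_mul_of_nonneg_left key hs.le
  have h3 : s * (δ * (y * φ)) = (1 - p) * (y * φ) := by rw [hps]; ring
  have h4 : s * ((1 - p / s * y) * (φ' - φ)) = (s - p * y) * (φ' - φ) := by field_simp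
  linarith

/-- If `rp(1 - p)` is not small, then below the mean the lower part, and above the mean the upper
part of the weights is controlled by the weight at `w`. -/
theorem sum_or_tail_le (hr : 0 < r) (hp : 0 < p) (hp1 : p < 1)
    (hX : 49 / 16 ≤ r * p * (1 - p)) (w : ℕ) :
    ∑ j ∈ Finset.range w, nbMass r p j ≤ 1.75 / √(r * p) * (w * nbMass r p w) ∨
      nbTail r p w ≤ 1.75 / √(r * p) * (w * nbMass r p w) := by
  have hq : 0 < 1 - p := by linarith
  have hrp : 0 < r * p := by positivity
  obtain ⟨s, hs⟩ : ∃ s, s = √(r * p) := ⟨_, rfl⟩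
  have hs0 : 0 < s := by rw [hs]; positivity
  have hsr : s ^ 2 = r * p := by rw [hs]; exact Real.sq_sqrt hrp.le
  have hwa : 0 ≤ w * nbMass r p w := mul_nonneg w.cast_nonneg (nbMass_pos hr hp hp1 w).le
  rw [← hs]
  rcases le_total ((1 - p) * (w : ℝ)) (s ^ 2) with h | h
  · left
    have hε : p / r ≤ 1 / 16 := by
      rw [div_le_iff₀ hr]
      -- The maximum is at p = 2/3: the difference of the two sides is (p - 2/3)²(p + 1/3). Then 16
      -- · 4/27 < 49/16 gives the claim.
      have h1 : p ^ 2 * (1 - p) ≤ 4 / 27 := by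
        nlinarith [mul_nonneg (sq_nonneg (p - 2 / 3)) (show 0 ≤ p + 1 / 3 by linarith)]
      have h2 : 0 < p * (1 - p) := by positivity
      refine le_of_mul_le_mul_left ?_ h2
      nlinarith
    refine (sum_nbMass_le_of_supersolution hr hp hp1
      (ψ := fun n => steinProfile ((s ^ 2 - (1 - p) * n) / s) / s) fun n hn => ?_).trans ?_
    · have hnw : (n : ℝ) ≤ w := by exact_mod_cast hn.le
      have := steinProfile_recursion_below (n := n) hr hp hp1 hs0 hsr hε n.cast_nonneg
        ((mul_le_mul_of_nonneg_left hnw hq.le).trans h)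
      simpa using this
    · refine mul_le_mul_of_nonneg_right ?_ hwa
      gcongr
      exact steinProfile_le (div_nonneg (by linarith) hs0.le)
  · right
    have hδ : (1 - p) / s ≤ 4 / 7 := by
      rw [div_le_iff₀ hs0]
      have h2 : (7 / 4 : ℝ) ≤ s := by
        refine le_of_sq_le_sq ?_ hs0.le
        nlinarith
      nlinarith
    refine (nbTail_le_of_supersolution hr hp hp1
      (ψ := fun n => steinProfile (((1 - p) * n - s ^ 2) / s) / s) (fun n => ?_)
      fun n hn => ?_).trans ?_
    · have := steinProfile_ge (((1 - p) * n - s ^ 2) / s)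
      exact div_nonneg (by linarith) hs0.le
    · have hnw : (w : ℝ) ≤ n := by exact_mod_cast hn
      have := steinProfile_recursion_above (n := n) hp hp1 hs0 hsr hδ
        (h.trans (mul_le_mul_of_nonneg_left hnw hq.le))
      simpa using this
    · refine mul_le_mul_of_nonneg_right ?_ hwa
      gcongr
      exact steinProfile_le (div_nonneg (by linarith) hs0.le)

end Supersolution

/-! ### The bound for the solution of Stein's equation -/

section Bound

variable {r p : ℝ}

theorem sum_mul_tail_le_inv (hr : 0 < r) (hp : 0 < p) (hp1 : p < 1) (w : ℕ) :
    (∑ j ∈ Finset.range w, nbMass r p j) * nbTail r p w ≤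
      1 / (1 - p) * (w * nbMass r p w * (∑ j ∈ Finset.range w, nbMass r p j + nbTail r p w)) := by
  have hq : 0 < 1 - p := by linarith
  have h := mul_add_excess_le hr hp hp1 w
  have hS : 0 ≤ ∑ j ∈ Finset.range w, nbMass r p j :=
    Finset.sum_nonneg fun j _ => (nbMass_pos hr hp hp1 j).le
  rw [one_div, inv_mul_eq_div, le_div_iff₀ hq]
  have := mul_nonneg hq.le (mul_nonneg hS (nbExcess_nonneg hr hp hp1 w))
  linarith

theorem sum_mul_tail_le_sqrt (hr : 0 < r) (hp : 0 < p) (hp1 : p < 1) (w : ℕ) :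
    (∑ j ∈ Finset.range w, nbMass r p j) * nbTail r p w ≤
      1.75 / √(r * p * (1 - p)) *
        (w * nbMass r p w * (∑ j ∈ Finset.range w, nbMass r p j + nbTail r p w)) := by
  have hq : 0 < 1 - p := by linarith
  have hX0 : 0 < r * p * (1 - p) := by positivity
  have hx0 : 0 < √(r * p * (1 - p)) := Real.sqrt_pos.2 hX0
  have hxsq : √(r * p * (1 - p)) ^ 2 = r * p * (1 - p) := Real.sq_sqrt hX0.le
  have h := mul_add_excess_le hr hp hp1 w
  have hS : 0 ≤ ∑ j ∈ Finset.range w, nbMass r p j :=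
    Finset.sum_nonneg fun j _ => (nbMass_pos hr hp hp1 j).le
  have hT := nbTail_pos hr hp hp1 w
  have hwa : 0 ≤ w * nbMass r p w := mul_nonneg w.cast_nonneg (nbMass_pos hr hp hp1 w).le
  have hlarge := sum_or_tail_le (w := w) hr hp hp1
  have hge := tail_le_excess_of_one_le (r := r) (w := w) (hp := hp) (hp1 := hp1)
  have hle := tail_le_excess_of_le_one (r := r) (w := w) (hr := hr) (hp := hp) (hp1 := hp1)
  have hsqrt : √(r * p * (1 - p)) ≤ √(r * p) :=
    Real.sqrt_le_sqrt (mul_le_of_le_one_right (by positivity) (by linarith))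
  set S := ∑ j ∈ Finset.range w, nbMass r p j
  set T := nbTail r p w
  set E := nbExcess r p w
  set x := √(r * p * (1 - p))
  have hST : 0 ≤ S * T := mul_nonneg hS hT.le
  -- Any lower bound c T for (1 - p)(T + E) with c ≥ x / 1.75 suffices, by `mul_add_excess_le`.
  have reduce : ∀ c : ℝ, x ≤ 1.75 * c → c * T ≤ (1 - p) * (T + E) →
      S * T ≤ 1.75 / x * (w * nbMass r p w * (S + T)) := by
    intro c hc1 hc2
    rw [div_mul_eq_mul_div, le_div_iff₀ hx0]
    have h1 := mul_le_mul_of_nonneg_left hc1 hST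
    have h2 := mul_le_mul_of_nonneg_left hc2 hS
    linarith
  rcases le_total r 1 with hr1 | hr1
  -- The bound on x follows from 4 (1 - p) pr ≤ (1 - p + pr)².
  · refine reduce (1 - p + p * r) ?_ (by linarith [hle hr1])
    refine le_of_sq_le_sq ?_ (by positivity)
    rw [hxsq]
    nlinarith [sq_nonneg (1 - p - p * r), sq_nonneg (1 - p + p * r)]
  rcases le_total (49 / 16) (r * p * (1 - p)) with hX | hX
  · have mono : 1.75 / √(r * p) * (w * nbMass r p w) ≤ 1.75 / x * (w * nbMass r p w) := by
      gcongr
    have hK : 0 ≤ 1.75 / x * (w * nbMass r p w) := by positivity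
    rcases hlarge hX with h1 | h1
    · nlinarith [mul_le_mul_of_nonneg_right (h1.trans mono) hT.le, mul_nonneg hK hS]
    · nlinarith [mul_le_mul_of_nonneg_right (h1.trans mono) hS, mul_nonneg hK hT.le]
  -- The threshold 49/16 is 1.75², so x ≤ 1.75 here.
  · refine reduce 1 ?_ (by linarith [hge hr1])
    refine le_of_sq_le_sq ?_ (by norm_num)
    rw [hxsq]
    norm_num
    linarith

/-- The equation at j times a_j has left side c_{j+1} - c_j with c_j = j a_j g(j); at j = m the
indicator removes c_m, so the undetermined value g(m) never enters. -/
theorem IsSteinSolution.mul_nbMass_eq {m : ℕ} (hr : 0 < r) {f g : ℕ → ℝ}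
    (hg : IsSteinSolution m r p f g) {i : ℕ} (hi : m ≤ i) :
    ((i + 1 : ℕ) : ℝ) * nbMass r p (i + 1) * g (i + 1) =
      ∑ j ∈ Finset.Ico m (i + 1), (f j - ∫ k, f k ∂(condNB m r p)) * nbMass r p j := by
  induction i, hi using Nat.le_induction with
  | base =>
    have e := hg m le_rfl
    simp only [steinOp, Set.mem_Ioi, lt_irrefl, not_false_eq_true, Set.indicator_of_notMem,
      mul_zero, sub_zero] at e
    rw [Nat.cast_add_one, nbMass_succ hr, Nat.Ico_succ_singleton, Finset.sum_singleton, ← e]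
    ring
  | succ n hn ih =>
    have e := hg (n + 1) (by omega)
    rw [steinOp, Set.indicator_of_mem (Set.mem_Ioi.2 (Nat.lt_succ_of_le hn)), Pi.one_apply,
      mul_one] at e
    rw [Finset.sum_Ico_succ_top (by omega), ← ih, ← e, Nat.cast_add_one (n + 1), nbMass_succ hr]
    ring

/-! ### The conditional law in terms of the weights -/

theorem nbMeasure_apply (r p : ℝ) (B : Set ℕ) :
    nbMeasure r p B = ∑' k, ENNReal.ofReal (B.indicator (nbMass r p) k) := by
  rw [nbMeasure, Measure.sum_apply _ (MeasurableSet.of_discrete)]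
  refine tsum_congr fun k => ?_
  by_cases hk : k ∈ B <;> simp [hk]

theorem nbMeasure_real_apply (hr : 0 < r) (hp : 0 < p) (hp1 : p < 1) (B : Set ℕ) :
    (nbMeasure r p).real B = ∑' k, B.indicator (nbMass r p) k := by
  have h0 : ∀ k, 0 ≤ B.indicator (nbMass r p) k := fun k =>
    Set.indicator_nonneg (fun j _ => (nbMass_pos hr hp hp1 j).le) k
  rw [measureReal_def, nbMeasure_apply, ← ENNReal.ofReal_tsum_of_nonneg h0
    ((summable_nbMass hr hp hp1).indicator B), ENNReal.toReal_ofReal (tsum_nonneg h0)]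

theorem tsum_indicator_eq_add_of_subset (hr : 0 < r) (hp : 0 < p) (hp1 : p < 1) {m w : ℕ}
    (hmw : m ≤ w) {A : Set ℕ} (hA : A ⊆ Set.Ici m) :
    ∑' k, A.indicator (nbMass r p) k = ∑ j ∈ Finset.Ico m w, A.indicator (nbMass r p) j +
      ∑' j, A.indicator (nbMass r p) (w + j) := by
  rw [← ((summable_nbMass hr hp hp1).indicator A).sum_add_tsum_nat_add w]
  simp only [add_comm _ w]
  congr 1
  rw [Finset.range_eq_Ico, ← Finset.sum_Ico_consecutive _ (Nat.zero_le m) hmw,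
    Finset.sum_eq_zero, zero_add]
  intro j hj
  refine Set.indicator_of_notMem (fun h => ?_) _
  have := Set.mem_Ici.1 (hA h)
  have := (Finset.mem_Ico.1 hj).2
  omega

/-- A quotient of masses, so the weights need not be known to sum to one. -/
theorem integral_indicator_condNB (m : ℕ) {A : Set ℕ} (hA : A ⊆ Set.Ici m) :
    ∫ k, A.indicator (1 : ℕ → ℝ) k ∂(condNB m r p) =
      ((nbMeasure r p).real (Set.Ici m))⁻¹ * (nbMeasure r p).real A := by
  rw [integral_indicator_one MeasurableSet.of_discrete, condNB,
    measureReal_def, ProbabilityTheory.cond_apply MeasurableSet.of_discrete,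
    Set.inter_eq_right.2 hA, ENNReal.toReal_mul, ENNReal.toReal_inv, measureReal_def,
    measureReal_def]

theorem IsSteinSolution.abs_apply_succ_le {m : ℕ} (hr : 0 < r) (hp : 0 < p) (hp1 : p < 1) {A : Set ℕ}
    (hA : A ⊆ Set.Ici m) {g : ℕ → ℝ} (hg : IsSteinSolution m r p (A.indicator 1) g)
    {w : ℕ} (hw : m ≤ w) {K : ℝ}
    (hK : (∑ j ∈ Finset.range (w + 1), nbMass r p j) * nbTail r p (w + 1) ≤
      K * ((w + 1 : ℕ) * nbMass r p (w + 1) *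
        (∑ j ∈ Finset.range (w + 1), nbMass r p j + nbTail r p (w + 1)))) :
    |g (w + 1)| ≤ K := by
  have ha := nbMass_pos hr hp hp1
  have hmw : m ≤ w + 1 := by omega
  have hind : ∀ j, 0 ≤ A.indicator (nbMass r p) j ∧ A.indicator (nbMass r p) j ≤ nbMass r p j :=
    fun j => ⟨Set.indicator_nonneg (fun j _ => (ha j).le) j,
      Set.indicator_le_self' (fun _ _ => (ha _).le) j⟩
  have hsol := IsSteinSolution.mul_nbMass_eq hr hg hw
  rw [integral_indicator_condNB m hA, nbMeasure_real_apply hr hp hp1,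
    nbMeasure_real_apply hr hp hp1, tsum_indicator_eq_add_of_subset hr hp hp1 hmw hA,
    tsum_indicator_eq_add_of_subset hr hp hp1 hmw subset_rfl] at hsol
  have e1 : ∑ j ∈ Finset.Ico m (w + 1), (Set.Ici m).indicator (nbMass r p) j =
      ∑ j ∈ Finset.Ico m (w + 1), nbMass r p j :=
    Finset.sum_congr rfl fun j hj => Set.indicator_of_mem (Finset.mem_Ico.1 hj).1 _
  have e2 : ∑' j, (Set.Ici m).indicator (nbMass r p) (w + 1 + j) = nbTail r p (w + 1) :=
    tsum_congr fun j => Set.indicator_of_mem (Set.mem_Ici.2 (by omega)) _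
  rw [e1, e2] at hsol
  simp only [sub_mul] at hsol
  have e3 : ∀ j, A.indicator (1 : ℕ → ℝ) j * nbMass r p j = A.indicator (nbMass r p) j := by
    intro j
    by_cases hj : j ∈ A <;> simp [hj]
  rw [Finset.sum_sub_distrib, ← Finset.mul_sum, Finset.sum_congr rfl fun j _ => e3 j] at hsol
  have hS' : ∑ j ∈ Finset.Ico m (w + 1), nbMass r p j ≤ ∑ j ∈ Finset.range (w + 1), nbMass r p j :=
    Finset.sum_le_sum_of_subset_of_nonneg (fun j hj => Finset.mem_range.2 (Finset.mem_Ico.1 hj).2)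
      fun j _ _ => (ha j).le
  have hU0 : 0 ≤ ∑ j ∈ Finset.Ico m (w + 1), A.indicator (nbMass r p) j :=
    Finset.sum_nonneg fun j _ => (hind j).1
  have hU1 : ∑ j ∈ Finset.Ico m (w + 1), A.indicator (nbMass r p) j ≤
      ∑ j ∈ Finset.Ico m (w + 1), nbMass r p j := Finset.sum_le_sum fun j _ => (hind j).2
  have hV0 : 0 ≤ ∑' j, A.indicator (nbMass r p) (w + 1 + j) := tsum_nonneg fun j => (hind _).1
  have hV1 : ∑' j, A.indicator (nbMass r p) (w + 1 + j) ≤ nbTail r p (w + 1) :=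
    Summable.tsum_le_tsum (fun j => (hind _).2)
      (Summable.of_nonneg_of_le (fun j => (hind _).1) (fun j => (hind _).2)
        (summable_nbMass_add hr hp hp1 _)) (summable_nbMass_add hr hp hp1 _)
  have hT := nbTail_pos hr hp hp1 (w + 1)
  have hb : 0 < ((w + 1 : ℕ) : ℝ) * nbMass r p (w + 1) := mul_pos (by positivity) (ha _)
  generalize ∑ j ∈ Finset.range (w + 1), nbMass r p j = S at *
  generalize ∑ j ∈ Finset.Ico m (w + 1), nbMass r p j = S' at *
  generalize ∑ j ∈ Finset.Ico m (w + 1), A.indicator (nbMass r p) j = U at *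
  generalize ∑' j, A.indicator (nbMass r p) (w + 1 + j) = V at *
  generalize nbTail r p (w + 1) = T at *
  generalize ((w + 1 : ℕ) : ℝ) * nbMass r p (w + 1) = b at *
  have hS0 : 0 ≤ S' := hU0.trans hU1
  have hpos : 0 < S' + T := by linarith
  have hpos' : 0 < S + T := by linarith
  have hsol' : b * (S' + T) * g (w + 1) = U * T - V * S' := by
    have : b * (S' + T) * g (w + 1) = (S' + T) * (b * g (w + 1)) := by ring
    rw [this, hsol]
    field_simp
    ring
  -- Passage from m = 0 to general m: S T (S' + T) - S' T (S + T) = (S - S') T² ≥ 0.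
  have hbK : S' * T ≤ K * (b * (S' + T)) := by
    refine le_of_mul_le_mul_left ?_ hpos'
    have h1 := mul_le_mul_of_nonneg_left hK hpos.le
    have h2 : 0 ≤ (S - S') * T ^ 2 := mul_nonneg (by linarith) (sq_nonneg T)
    nlinarith
  have hd : 0 < b * (S' + T) := mul_pos hb hpos
  have h1 := mul_le_mul_of_nonneg_right hU1 hT.le
  have h2 := mul_le_mul_of_nonneg_right hV1 hS0
  have h3 := mul_nonneg hU0 hT.le
  have h4 := mul_nonneg hV0 hS0
  -- U T and V S' both lie in [0, S'T], hence so does the absolute value of their difference.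
  refine abs_le.2 ⟨?_, ?_⟩
  · refine le_of_mul_le_mul_left ?_ hd
    linarith
  · refine le_of_mul_le_mul_left ?_ hd
    linarith

end Bound

theorem mainTheorem8 (m : ℕ) (r p : ℝ) (hr : 0 < r) (hp : 0 < p) (hp1 : p < 1) :
    steinFactorOne m hr hp ≤
      ENNReal.ofReal (min (1 / (1 - p)) (1.75 / Real.sqrt (r * p * (1 - p)))) := by
  refine iSup₂_le fun f hf => iSup₂_le fun w hw => ENNReal.ofReal_le_ofReal ?_
  obtain ⟨A, hA, rfl⟩ := hf
  have hg : IsSteinSolution m r p (A.indicator 1) (steinSol m hr hp (A.indicator 1)) :=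
    Classical.choose_spec (exists_isSteinSolution m hr hp (A.indicator 1))
  exact le_min (IsSteinSolution.abs_apply_succ_le hr hp hp1 hA hg hw
      (sum_mul_tail_le_inv hr hp hp1 (w + 1)))
    (IsSteinSolution.abs_apply_succ_le hr hp hp1 hA hg hw
      (sum_mul_tail_le_sqrt hr hp hp1 (w + 1)))
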